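/- Let $\mathbf{Meas}$ be the category of measurable spaces and measurable maps, and let $\mathcal G$ be the Giry monad on $\mathbf{Meas}$: $\mathcal G X$ is the set of probability measures on $X$ with the $\sigma$-algebra generated by the evaluations $\mu\mapsto\mu(S)$ for measurable $S\subseteq X$, $\mathcal G$ acts on measurable maps by pushforward, its unit is $x\mapsto\delta_x$, and its multiplication sends $P\in\mathcal G\mathcal G X$ to the measure $S\mapsto\int_{\mathcal G X}\nu(S)\,dP(\nu)$. Let $\mathcal D$ be the discrete distribution monad on $\mathbf{Set}$: $\mathcal D A=\{p\colon A\to[0,1]\mid\sum_{a\in A}p(a)=1\}$, with pushforward of distributions as action on maps, point masses as unit and averaging as multiplication. Equip $\mathcal D A$ with the $\sigma$-algebra induced from the power $[0,1]^A$ in $\mathbf{Meas}$, where $[0,1]$ carries its Borel $\sigma$-algebra. Let $\mathbf{Set}_{\mathsf c}$ be the category of countable (possibly finite or empty) sets and all maps, and let $\mathbf{Kl}_{\mathsf c}(\mathcal D)$ be the full subcategory of the Kleisli category of $\mathcal D$ on the countable sets, so that a morphism $A\to B$ is a map $f\colon A\to\mathcal D B$. This gives two functors to $\mathbf{Meas}$: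 $\mathcal D\colon\mathbf{Set}_{\mathsf c}\to\mathbf{Meas}$, and the forgetful functor $U_{\mathcal D}\colon\mathbf{Kl}_{\mathsf c}(\mathcal D)\to\mathbf{Meas}$, which sends $A$ to $\mathcal D A$ and $f\colon A\to\mathcal D B$ to the map $\mathcal D A\to\mathcal D B$, $p\mapsto\bigl(b\mapsto\sum_{a\in A}p(a)\,f(a)(b)\bigr)$. For a functor $F\colon\mathbf A\to\mathbf C$ whose right Kan extension $\mathrm{Ran}_F F$ along itself exists, with counit $\varphi\colon(\mathrm{Ran}_F F)F\to F$, the codensity monad of $F$ is $(\mathrm{Ran}_F F,\eta,\mu)$, where $\eta\colon\mathrm{Id}\to\mathrm{Ran}_F F$ and $\mu\colon(\mathrm{Ran}_F F)(\mathrm{Ran}_F F)\to\mathrm{Ran}_F F$ correspond, under the universal property of $\mathrm{Ran}_F F$, to $\mathrm{id}_F$ and to $\varphi\circ(\mathrm{Ran}_F F)\varphi$. **Theorem.** 1. The right Kan extension of $\mathcal D\colon\mathbf{Set}_{\mathsf c}\to\mathbf{Meas}$ along itself exists and is pointwise, and the Giry monad $\mathcal G$ is isomorphic, as a monad, to the codensity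 monad of $\mathcal D\colon\mathbf{Set}_{\mathsf c}\to\mathbf{Meas}$. 2. The right Kan extension of $U_{\mathcal D}\colon\mathbf{Kl}_{\mathsf c}(\mathcal D)\to\mathbf{Meas}$ along itself exists and is pointwise, and the Giry monad $\mathcal G$ is isomorphic, as a monad, to the codensity monad of $U_{\mathcal D}$. -/

import Mathlib

open CategoryTheory MeasureTheory

universe u v₁ v₂ u₁ u₂

noncomputable section

namespace Codensity

section General

variable {A : Type u₁} [Category.{v₁} A] {C : Type u₂} [Category.{v₂} C]

/-- The unit `𝟭 ⟶ Ran_F F`: the transformation corresponding to `id : F ⟶ F`. -/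
def unit (F : A ⥤ C) [F.HasRightKanExtension F] : 𝟭 C ⟶ F.rightKanExtension F :=
  (F.rightKanExtension F).liftOfIsRightKanExtension (F.rightKanExtensionCounit F) (𝟭 C)
    F.rightUnitor.hom

/-- The multiplication `(Ran_F F)(Ran_F F) ⟶ Ran_F F`: the transformation corresponding to
`(Ran_F F)(Ran_F F) F ⟶ (Ran_F F) F ⟶ F`, the counit applied twice. -/
def mult (F : A ⥤ C) [F.HasRightKanExtension F] :
    F.rightKanExtension F ⋙ F.rightKanExtension F ⟶ F.rightKanExtension F :=
  (F.rightKanExtension F).liftOfIsRightKanExtension (F.rightKanExtensionCounit F)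
    (F.rightKanExtension F ⋙ F.rightKanExtension F)
    ((Functor.associator _ _ _).inv ≫
      Functor.whiskerRight (F.rightKanExtensionCounit F) (F.rightKanExtension F) ≫
      F.rightKanExtensionCounit F)

theorem unit_fac (F : A ⥤ C) [F.HasRightKanExtension F] (a : A) :
    (unit F).app (F.obj a) ≫ (F.rightKanExtensionCounit F).app a = 𝟙 (F.obj a) := by
  simp [unit]

theorem mult_fac (F : A ⥤ C) [F.HasRightKanExtension F] (a : A) :
    (mult F).app (F.obj a) ≫ (F.rightKanExtensionCounit F).app a =
      (F.rightKanExtension F).map ((F.rightKanExtensionCounit F).app a) ≫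
        (F.rightKanExtensionCounit F).app a := by
  simp [mult]

/-- Two transformations into `Ran_F F` agree if they agree after composition with the counit. -/
theorem ran_hom_ext_app (F : A ⥤ C) [F.HasRightKanExtension F] {G : C ⥤ C}
    (γ₁ γ₂ : G ⟶ F.rightKanExtension F)
    (h : ∀ a, γ₁.app (F.obj a) ≫ (F.rightKanExtensionCounit F).app a =
      γ₂.app (F.obj a) ≫ (F.rightKanExtensionCounit F).app a) : γ₁ = γ₂ := by
  apply Functor.rightKanExtension_hom_ext
  ext a
  exact h a

/-- The codensity monad `(Ran_F F, η, μ)` of a functor `F` that has a right Kan extension along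
itself. -/
def codensityMonad (F : A ⥤ C) [F.HasRightKanExtension F] : Monad C where
  toFunctor := F.rightKanExtension F
  η := unit F
  μ := mult F
  assoc X := by
    let T := F.rightKanExtension F
    have := ran_hom_ext_app F (G := T ⋙ T ⋙ T)
      (Functor.whiskerRight (mult F) T ≫ mult F)
      (Functor.whiskerLeft T (mult F) ≫ mult F) (fun a => by
        have h1 := (mult F).naturality ((F.rightKanExtensionCounit F).app a)
        dsimp at h1
        simp only [NatTrans.comp_app, Functor.whiskerRight_app, Functor.whiskerLeft_app,
          Category.assoc, mult_fac, T]
        rw [← Functor.map_comp_assoc, mult_fac, ← reassoc_of% h1, mult_fac,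
          Functor.map_comp_assoc])
    exact NatTrans.congr_app this X
  left_unit X := by
    let T := F.rightKanExtension F
    have := ran_hom_ext_app F (G := T) (Functor.whiskerLeft T (unit F) ≫ mult F) (𝟙 T)
      (fun a => by
        have h1 := (unit F).naturality ((F.rightKanExtensionCounit F).app a)
        dsimp at h1
        simp only [NatTrans.comp_app, Functor.whiskerLeft_app, Category.assoc, mult_fac, T]
        erw [← reassoc_of% h1, unit_fac]
        simp)
    exact NatTrans.congr_app this X
  right_unit X := by
    let T := F.rightKanExtension F
    have := ran_hom_ext_app F (G := T) (Functor.whiskerRight (unit F) T ≫ mult F) (𝟙 T)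
      (fun a => by
        simp only [NatTrans.comp_app, Functor.whiskerRight_app, Category.assoc, mult_fac, T]
        rw [← Functor.map_comp_assoc]
        erw [unit_fac]
        simp)
    exact NatTrans.congr_app this X

/-- `T` is the codensity monad of `F`: the right Kan extension of `F` along itself exists, is
pointwise, and `T` is isomorphic to the codensity monad of `F` in the category of monads. -/
def IsCodensityMonadOf (T : Monad C) (F : A ⥤ C) : Prop :=
  ∃ _ : F.HasPointwiseRightKanExtension F, Nonempty (T ≅ codensityMonad F)

end General

section Giry

theorem measurable_prob_toMeasure {X : Type u} [MeasurableSpace X] :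
    Measurable (ProbabilityMeasure.toMeasure : ProbabilityMeasure X → Measure X) :=
  measurable_subtype_coe

theorem measurable_prob_coe {X : Type u} [MeasurableSpace X] {s : Set X} (hs : MeasurableSet s) :
    Measurable fun ν : ProbabilityMeasure X => (ν : Measure X) s :=
  (Measure.measurable_coe hs).comp measurable_prob_toMeasure

theorem measurable_of_measurable_prob_coe {X Y : Type u} [MeasurableSpace X] [MeasurableSpace Y]
    (f : Y → ProbabilityMeasure X)
    (h : ∀ s, MeasurableSet s → Measurable fun y => (f y : Measure X) s) : Measurable f :=
  Measurable.subtype_mk (Measure.measurable_of_measurable_coe _ h)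

theorem prob_ext {X : Type u} [MeasurableSpace X] {μ ν : ProbabilityMeasure X}
    (h : ∀ s, MeasurableSet s → (μ : Measure X) s = (ν : Measure X) s) : μ = ν :=
  Subtype.ext (Measure.ext h)

theorem isProbabilityMeasure_join {X : Type u} [MeasurableSpace X]
    (P : ProbabilityMeasure (ProbabilityMeasure X)) :
    IsProbabilityMeasure
      (Measure.join ((P : Measure (ProbabilityMeasure X)).map ProbabilityMeasure.toMeasure)) := by
  constructor
  rw [Measure.join_apply MeasurableSet.univ,
    lintegral_map (Measure.measurable_coe MeasurableSet.univ) measurable_prob_toMeasure]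
  simp

/-- The pushforward of a probability measure along a measurable map. -/
def probMap {X Y : Type u} [MeasurableSpace X] [MeasurableSpace Y] (f : X → Y) (hf : Measurable f)
    (μ : ProbabilityMeasure X) : ProbabilityMeasure Y :=
  μ.map hf.aemeasurable

/-- The Dirac measure as a probability measure. -/
def probDirac {X : Type u} [MeasurableSpace X] (x : X) : ProbabilityMeasure X :=
  ⟨Measure.dirac x, inferInstance⟩

/-- The averaging map `P ↦ (s ↦ ∫ ν s dP(ν))` on probability measures. -/
def probJoin {X : Type u} [MeasurableSpace X]
    (P : ProbabilityMeasure (ProbabilityMeasure X)) : ProbabilityMeasure X :=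
  ⟨Measure.join ((P : Measure (ProbabilityMeasure X)).map ProbabilityMeasure.toMeasure),
    isProbabilityMeasure_join P⟩

theorem probMap_apply {X Y : Type u} [MeasurableSpace X] [MeasurableSpace Y] {f : X → Y}
    (hf : Measurable f) (μ : ProbabilityMeasure X) {s : Set Y} (hs : MeasurableSet s) :
    (probMap f hf μ : Measure Y) s = (μ : Measure X) (f ⁻¹' s) :=
  Measure.map_apply hf hs

theorem lintegral_probMap {X Y : Type u} [MeasurableSpace X] [MeasurableSpace Y] {f : X → Y}
    (hf : Measurable f) (μ : ProbabilityMeasure X) {g : Y → ENNReal} (hg : Measurable g) :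
    ∫⁻ y, g y ∂(probMap f hf μ : Measure Y) = ∫⁻ x, g (f x) ∂(μ : Measure X) :=
  lintegral_map hg hf

theorem probJoin_apply {X : Type u} [MeasurableSpace X]
    (P : ProbabilityMeasure (ProbabilityMeasure X)) {s : Set X} (hs : MeasurableSet s) :
    (probJoin P : Measure X) s =
      ∫⁻ ν, (ν : Measure X) s ∂(P : Measure (ProbabilityMeasure X)) := by
  change Measure.join _ s = _
  rw [Measure.join_apply hs, lintegral_map (Measure.measurable_coe hs) measurable_prob_toMeasure]

theorem lintegral_probJoin {X : Type u} [MeasurableSpace X]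
    (P : ProbabilityMeasure (ProbabilityMeasure X)) {g : X → ENNReal} (hg : Measurable g) :
    ∫⁻ x, g x ∂(probJoin P : Measure X) =
      ∫⁻ ν, ∫⁻ x, g x ∂(ν : Measure X) ∂(P : Measure (ProbabilityMeasure X)) := by
  change ∫⁻ x, g x ∂(Measure.join _) = _
  rw [Measure.lintegral_join hg.aemeasurable,
    lintegral_map (Measure.measurable_lintegral hg) measurable_prob_toMeasure]

theorem measurable_probMap {X Y : Type u} [MeasurableSpace X] [MeasurableSpace Y] {f : X → Y}
    (hf : Measurable f) : Measurable (probMap f hf) :=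
  measurable_of_measurable_prob_coe _ fun s hs => by
    simp only [probMap_apply hf _ hs]
    exact measurable_prob_coe (hf hs)

theorem measurable_probDirac {X : Type u} [MeasurableSpace X] :
    Measurable (probDirac : X → ProbabilityMeasure X) :=
  Measurable.subtype_mk Measure.measurable_dirac

theorem measurable_probJoin {X : Type u} [MeasurableSpace X] :
    Measurable (probJoin : ProbabilityMeasure (ProbabilityMeasure X) → ProbabilityMeasure X) :=
  measurable_of_measurable_prob_coe _ fun s hs => by
    simp only [probJoin_apply _ hs]
    exact (Measure.measurable_lintegral (measurable_prob_coe hs)).comp measurable_prob_toMeasure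

theorem probMap_probDirac {X Y : Type u} [MeasurableSpace X] [MeasurableSpace Y] {f : X → Y}
    (hf : Measurable f) (x : X) : probMap f hf (probDirac x) = probDirac (f x) :=
  Subtype.ext (Measure.map_dirac' hf x)

theorem probJoin_probMap_probMap {X Y : Type u} [MeasurableSpace X] [MeasurableSpace Y]
    {f : X → Y} (hf : Measurable f) (P : ProbabilityMeasure (ProbabilityMeasure X)) :
    probJoin (probMap (probMap f hf) (measurable_probMap hf) P) = probMap f hf (probJoin P) :=
  prob_ext fun s hs => by
    rw [probMap_apply hf _ hs, probJoin_apply _ hs, probJoin_apply _ (hf hs),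
      lintegral_probMap _ _ (measurable_prob_coe hs)]
    exact lintegral_congr fun ν => probMap_apply hf ν hs

theorem probJoin_probMap_probJoin {X : Type u} [MeasurableSpace X]
    (P : ProbabilityMeasure (ProbabilityMeasure (ProbabilityMeasure X))) :
    probJoin (probMap probJoin measurable_probJoin P) = probJoin (probJoin P) :=
  prob_ext fun s hs => by
    rw [probJoin_apply _ hs, lintegral_probMap _ _ (measurable_prob_coe hs), probJoin_apply _ hs,
      lintegral_probJoin _ (measurable_prob_coe hs)]
    exact lintegral_congr fun ν => probJoin_apply ν hs

theorem probJoin_probDirac {X : Type u} [MeasurableSpace X] (μ : ProbabilityMeasure X) :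
    probJoin (probDirac μ) = μ :=
  prob_ext fun s hs => by
    rw [probJoin_apply _ hs]
    exact lintegral_dirac' _ (measurable_prob_coe hs)

theorem probJoin_probMap_probDirac {X : Type u} [MeasurableSpace X] (μ : ProbabilityMeasure X) :
    probJoin (probMap probDirac measurable_probDirac μ) = μ :=
  prob_ext fun s hs => by
    rw [probJoin_apply _ hs, lintegral_probMap _ _ (measurable_prob_coe hs)]
    refine (lintegral_congr fun x => Measure.dirac_apply' x hs).trans ?_
    exact lintegral_indicator_one hs

/-- The functor sending a measurable space to its space of probability measures, with the
`σ`-algebra generated by the evaluations at measurable sets. -/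
def giryFunctor : MeasCat.{u} ⥤ MeasCat.{u} where
  obj X := MeasCat.of (ProbabilityMeasure X)
  map f := ⟨probMap f.1 f.2, measurable_probMap f.2⟩
  map_id _ := Subtype.ext <| funext fun _ => Subtype.ext <| Measure.map_id
  map_comp f g := Subtype.ext <| funext fun _ => Subtype.ext <| (Measure.map_map g.2 f.2).symm

/-- The Giry monad of probability measures: the unit is given by Dirac measures, the
multiplication by averaging. -/
def giryMonad : Monad MeasCat.{u} where
  toFunctor := giryFunctor
  η :=
    { app := fun _ => ⟨probDirac, measurable_probDirac⟩
      naturality := fun _ _ f => Subtype.ext <| funext fun x => (probMap_probDirac f.2 x).symm }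
  μ :=
    { app := fun _ => ⟨probJoin, measurable_probJoin⟩
      naturality := fun _ _ f => Subtype.ext <| funext fun P => probJoin_probMap_probMap f.2 P }
  assoc _ := Subtype.ext <| funext fun P => probJoin_probMap_probJoin P
  left_unit _ := Subtype.ext <| funext fun μ => probJoin_probDirac μ
  right_unit _ := Subtype.ext <| funext fun μ => probJoin_probMap_probDirac μ

end Giry

section Distribution

/-- The discrete distribution monad `D` on sets: `D X` is the set of maps `p : X → [0,1]` with
`∑ x, p x = 1`, with Dirac distributions as unit and averaging as multiplication. -/
def distMonad : Monad (Type u) := ofTypeMonad PMF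

/-- The `σ`-algebra on `D X` as a subspace of the power `[0,1]^X`; the values of a `PMF` lie in
`ℝ≥0∞`, of which `[0,1]` is a measurable subspace. -/
@[reducible] def distMeasurableSpace (X : Type u) : MeasurableSpace (PMF X) :=
  MeasurableSpace.comap (fun p x => p x) MeasurableSpace.pi

/-- The set of discrete distributions on `X` as a measurable space. -/
def distSpace (X : Type u) : MeasCat.{u} :=
  @MeasCat.of (PMF X) (distMeasurableSpace X)

theorem measurable_dist_bind {X Y : Type u} [Countable X] (f : X → PMF Y) :
    @Measurable _ _ (distMeasurableSpace X) (distMeasurableSpace Y) fun p => p.bind f := by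
  let _ := distMeasurableSpace X
  have hX : ∀ x, Measurable fun p : PMF X => p x := fun x =>
    (measurable_pi_apply x).comp (comap_measurable _)
  refine measurable_comap_iff.2 (measurable_pi_lambda _ fun y => ?_)
  simp only [Function.comp_def, PMF.bind_apply]
  exact Measurable.tsum fun x => (hX x).mul_const _

/-- A Kleisli morphism of `D` as a function. -/
def kleisliFun {X Y : Kleisli distMonad.{u}} (f : X ⟶ Y) : X.of → PMF Y.of :=
  fun x => f.of x

/-- The action of the functor `D` on maps is the pushforward of distributions. -/
theorem distMonad_map_apply {X Y : Type u} (f : X ⟶ Y) (p : PMF X) :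
    distMonad.map f p = p.map f := rfl

/-- The map `μ ∘ D f` of a Kleisli morphism `f` sends `p` to `y ↦ ∑ x, p x * f x y`. -/
theorem fromKleisli_map_apply {X Y : Kleisli distMonad.{u}} (f : X ⟶ Y) (p : PMF X.of) :
    (Kleisli.Adjunction.fromKleisli distMonad).map f p = p.bind (kleisliFun f) :=
  PMF.bind_map p (kleisliFun f) id

theorem bind_kleisliFun_comp {X Y Z : Kleisli distMonad.{u}} (f : X ⟶ Y) (g : Y ⟶ Z)
    (p : PMF X.of) :
    p.bind (kleisliFun (f ≫ g)) = (p.bind (kleisliFun f)).bind (kleisliFun g) := by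
  rw [PMF.bind_bind]
  congr 1
  funext x
  exact fromKleisli_map_apply g (kleisliFun f x)

/-- The category of countable sets. -/
abbrev CountableSet : Type (u + 1) :=
  ObjectProperty.FullSubcategory fun X : Type u => Countable X

/-- The functor `D` from countable sets to measurable spaces. -/
def distFunctor : CountableSet.{u} ⥤ MeasCat.{u} where
  obj X := distSpace X.obj
  map {X _} f := ⟨fun p : PMF X.obj => p.map f.hom,
    have := X.property
    measurable_dist_bind (PMF.pure ∘ f.hom)⟩
  map_id _ := Subtype.ext <| funext fun p => PMF.map_id p
  map_comp f g := Subtype.ext <| funext fun p => (PMF.map_comp f.hom p g.hom).symm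

/-- The full subcategory of the Kleisli category of `D` given by the countable sets. -/
abbrev CountableKleisli : Type (u + 1) :=
  ObjectProperty.FullSubcategory fun X : Kleisli distMonad.{u} => Countable X.of

/-- The forgetful functor `X ↦ D X`, `f ↦ μ ∘ D f`, from the Kleisli category of `D` on countable
sets, with values in measurable spaces. -/
def kleisliForget : CountableKleisli.{u} ⥤ MeasCat.{u} where
  obj X := distSpace X.obj.of
  map {X _} f := ⟨fun p : PMF X.obj.of => p.bind (kleisliFun f.hom),
    have := X.property
    measurable_dist_bind (kleisliFun f.hom)⟩
  map_id _ := Subtype.ext <| funext fun p => PMF.bind_pure p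
  map_comp f g := Subtype.ext <| funext fun p => bind_kleisliFun_comp f.hom g.hom p

end Distribution

end Codensity

end

/-! By the limit formula, the extension at `X` classifies families `α` that send each measurable `f
: X → D A` to a distribution on `A`, naturally in the countable set `A`. Averaging `f` against a
probability measure on `X` gives such a family; the point is that there are no others.

Reading off one coordinate of `D` of a two-point set turns `α` into a functional `Φ` on measurable
`[0,1]`-valued functions. A sequence of functions with sum at most `1` is, after completion, a
single map into `D(ℕ + 1)`, and naturality along the map collapsing `ℕ` to a point makes `Φ`
countably additive; it is normalized because `D 1` is a point. This already makes `Φ` an integral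
(`exists_prob_lintegral_eq`): on indicators it is a measure, halving gives homogeneity for powers of
`1/2`, and binary digits express every function through such multiples of indicators. Hence
`exists_prob_average_eq`; as `μ ↦ μ(S)` is itself a coordinate of an average, the measure is unique
and depends measurably on parameters.

Existence uses naturality in plain maps only, so one argument serves both functors. The counit is
the barycenter, which commutes with all Kleisli maps and is an algebra structure for the Giry monad;
this identifies the monads. -/

noncomputable section

namespace Codensity

open scoped ENNReal

/-! ### Recognizing a codensity monad -/

section General

variable {A : Type u₁} [Category.{v₁} A] {C : Type u₂} [Category.{v₂} C]

/-- A monad `T` with a transformation `ε : T F ⟶ F` exhibiting it as a pointwise right Kan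
extension of `F` along itself is the codensity monad of `F` as soon as `ε` makes every `F a` a
`T`-algebra. -/
theorem isCodensityMonadOf_of_isPointwise (T : Monad C) (F : A ⥤ C)
    (ε : F ⋙ T.toFunctor ⟶ F)
    (hε : (Functor.RightExtension.mk T.toFunctor ε).IsPointwiseRightKanExtension)
    (hη : ∀ a, T.η.app (F.obj a) ≫ ε.app a = 𝟙 (F.obj a))
    (hμ : ∀ a, T.μ.app (F.obj a) ≫ ε.app a = T.map (ε.app a) ≫ ε.app a) :
    IsCodensityMonadOf T F := by
  have : F.HasPointwiseRightKanExtension F := hε.hasPointwiseRightKanExtension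
  refine ⟨this, ⟨?_⟩⟩
  have hT : T.toFunctor.IsRightKanExtension ε := hε.isRightKanExtension
  let e : T.toFunctor ≅ F.rightKanExtension F :=
    T.toFunctor.rightKanExtensionUnique ε (F.rightKanExtension F) (F.rightKanExtensionCounit F)
  have he : ∀ a, e.hom.app (F.obj a) ≫ (F.rightKanExtensionCounit F).app a = ε.app a := fun a => by
    simp [e, Functor.rightKanExtensionUnique]
  -- Maps into the Kan extension are tested against the counit, which `e` carries to `ε`; there the
  -- two monad conditions become `hη` and `hμ`.
  refine MonadIso.mk (N := codensityMonad F) e (fun X => ?_) (fun X => ?_)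
  · have := ran_hom_ext_app F (T.η ≫ e.hom) (unit F) fun a => by
      rw [NatTrans.comp_app, Category.assoc, he, hη, unit_fac]
    exact NatTrans.congr_app this X
  · have := ran_hom_ext_app F (T.μ ≫ e.hom)
      (Functor.whiskerRight e.hom T.toFunctor ≫
        Functor.whiskerLeft (F.rightKanExtension F) e.hom ≫ mult F) fun a => by
      have h1 := e.hom.naturality ((F.rightKanExtensionCounit F).app a)
      rw [NatTrans.comp_app, Category.assoc, he, hμ]
      simp only [NatTrans.comp_app, Functor.whiskerRight_app, Functor.whiskerLeft_app,
        Category.assoc, mult_fac]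
      rw [← reassoc_of% h1, he, ← Functor.map_comp_assoc, he]
    have h2 := NatTrans.congr_app this X
    simp only [NatTrans.comp_app, Functor.whiskerRight_app, Functor.whiskerLeft_app] at h2
    rw [Category.assoc]
    exact h2

end General

/-! ### Countably additive functionals are integrals -/

section Representation

/-- What remains of a number after its first `n` binary digits are removed. -/
def binaryRemainder : ℕ → ℝ≥0∞ → ℝ≥0∞
  | 0, t => t
  | n + 1, t =>
    if (2⁻¹ : ℝ≥0∞) ^ (n + 1) ≤ binaryRemainder n t then
      binaryRemainder n t - 2⁻¹ ^ (n + 1)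
    else binaryRemainder n t

/-- Binary expansion: the digits of a number in `[0, 1]` can be chosen measurably. -/
theorem exists_binary_expansion : ∃ S : ℕ → Set ℝ≥0∞, (∀ n, MeasurableSet (S n)) ∧
    ∀ t ≤ 1, ∑' n, (S n).indicator (fun _ => (2⁻¹ : ℝ≥0∞) ^ (n + 1)) t = t := by
  let r := binaryRemainder
  have r_succ : ∀ n t, r (n + 1) t =
      if (2⁻¹ : ℝ≥0∞) ^ (n + 1) ≤ r n t then r n t - 2⁻¹ ^ (n + 1) else r n t := fun _ _ => rfl
  have hr : ∀ n, Measurable (r n) := by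
    intro n
    induction n with
    | zero => exact measurable_id
    | succ n ih =>
      exact Measurable.ite (measurableSet_le measurable_const ih) (ih.sub_const _) ih
  have half : ∀ n, (2⁻¹ : ℝ≥0∞) ^ n = 2⁻¹ ^ (n + 1) + 2⁻¹ ^ (n + 1) := fun n => by
    rw [pow_succ, ← mul_add, ENNReal.inv_two_add_inv_two, mul_one]
  refine ⟨fun n => {t | (2⁻¹ : ℝ≥0∞) ^ (n + 1) ≤ r n t},
    fun n => measurableSet_le measurable_const (hr n), fun t ht => ?_⟩
  -- The bound is not strict: for `t = 1` every digit is `1` and equality holds throughout.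
  have r_le : ∀ n, r n t ≤ 2⁻¹ ^ n := by
    intro n
    induction n with
    | zero => simpa [r, binaryRemainder] using ht
    | succ n ih =>
      rw [r_succ]
      split_ifs with h
      · rw [tsub_le_iff_right, ← half]
        exact ih
      · exact (not_le.1 h).le
  have hsum : ∀ n, ∑ i ∈ Finset.range n,
      {t | (2⁻¹ : ℝ≥0∞) ^ (i + 1) ≤ r i t}.indicator (fun _ => (2⁻¹ : ℝ≥0∞) ^ (i + 1)) t
        + r n t = t := by
    intro n
    induction n with
    | zero => simp [r, binaryRemainder]
    | succ n ih =>
      rw [Finset.sum_range_succ, add_assoc]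
      refine Eq.trans ?_ ih
      congr 1
      rw [r_succ]
      by_cases h : (2⁻¹ : ℝ≥0∞) ^ (n + 1) ≤ r n t
      · rw [if_pos h, Set.indicator_of_mem (by exact h), add_tsub_cancel_of_le h]
      · rw [if_neg h, Set.indicator_of_notMem (by exact h), zero_add]
  have hlim : Filter.Tendsto (fun n => r n t) Filter.atTop (nhds 0) :=
    tendsto_of_tendsto_of_tendsto_of_le_of_le tendsto_const_nhds
      (ENNReal.tendsto_pow_atTop_nhds_zero_of_lt_one (by simp)) (fun _ => zero_le) r_le
  have h := (ENNReal.tendsto_nat_tsum (fun i =>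
    {t | (2⁻¹ : ℝ≥0∞) ^ (i + 1) ≤ r i t}.indicator (fun _ => (2⁻¹ : ℝ≥0∞) ^ (i + 1)) t)).add hlim
  simp only [hsum, add_zero] at h
  exact tendsto_nhds_unique h tendsto_const_nhds

variable {X : Type u} [MeasurableSpace X]

/-- A normalized functional on measurable `[0, 1]`-valued functions that is countably additive
whenever the sum is again `[0, 1]`-valued is the integral against a probability measure. -/
theorem exists_prob_lintegral_eq (Φ : (X → ℝ≥0∞) → ℝ≥0∞) (h1 : Φ (fun _ => 1) = 1)
    (hΦ : ∀ g : ℕ → X → ℝ≥0∞, (∀ n, Measurable (g n)) → (∀ x, ∑' n, g n x ≤ 1) →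
      Φ (fun x => ∑' n, g n x) = ∑' n, Φ (g n)) :
    ∃ μ : ProbabilityMeasure X, ∀ g : X → ℝ≥0∞, Measurable g → (∀ x, g x ≤ 1) →
      Φ g = ∫⁻ x, g x ∂(μ : Measure X) := by
  -- Otherwise `0 = 0 + 0 + ⋯` forces `Φ 0 = ∞`, and `1 = 1 + 0 + 0 + ⋯` then contradicts `Φ 1 = 1`.
  have h0 : Φ (fun _ => 0) = 0 := by
    by_contra h
    have h2 := hΦ (fun n _ => if n = 0 then 1 else 0) (fun n => measurable_const) (by simp)
    have h3 := hΦ (fun _ _ => 0) (fun n => measurable_const) (by simp)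
    rw [ENNReal.tsum_const_eq_top_of_ne_zero h, tsum_zero] at h3
    simp only [tsum_ite_eq, h1] at h2
    have h4 := ENNReal.le_tsum (f := fun n : ℕ => Φ fun _ : X => if n = 0 then 1 else 0) 1
    rw [← h2] at h4
    simp [h3] at h4
  have hadd : ∀ f g : X → ℝ≥0∞, Measurable f → Measurable g → (∀ x, f x + g x ≤ 1) →
      Φ (fun x => f x + g x) = Φ f + Φ g := by
    intro f g hf hg hfg
    let k : ℕ → X → ℝ≥0∞ := fun n => if n = 0 then f else if n = 1 then g else fun _ => 0
    have hk : ∀ x, ∑' n, k n x = f x + g x := fun x => by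
      rw [tsum_eq_sum (s := Finset.range 2)]
      · simp [Finset.sum_range_succ, k]
      · intro n hn
        rw [Finset.mem_range] at hn
        simp [k, show n ≠ 0 by omega, show n ≠ 1 by omega]
    have hkm : ∀ n, Measurable (k n) := fun n => by
      dsimp only [k]
      split_ifs
      exacts [hf, hg, measurable_const]
    have h := hΦ k hkm
      (fun x => (hk x).trans_le (hfg x))
    simp only [hk] at h
    rw [h, tsum_eq_sum (s := Finset.range 2)]
    · simp [Finset.sum_range_succ, k]
    · intro n hn
      rw [Finset.mem_range] at hn
      simp [k, show n ≠ 0 by omega, show n ≠ 1 by omega, h0]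
  -- Halving is the only homogeneity that additivity gives directly, and the only one that binary
  -- expansions need.
  have hscale : ∀ (n : ℕ) (s : Set X), MeasurableSet s →
      Φ (s.indicator fun _ => 2⁻¹ ^ n) = 2⁻¹ ^ n * Φ (s.indicator fun _ => 1) := by
    intro n s hs
    induction n with
    | zero => simp
    | succ n ih =>
      have half : (2⁻¹ : ℝ≥0∞) ^ (n + 1) + 2⁻¹ ^ (n + 1) = 2⁻¹ ^ n := by
        rw [pow_succ, ← mul_add, ENNReal.inv_two_add_inv_two, mul_one]
      have hm : Measurable (s.indicator fun _ => (2⁻¹ : ℝ≥0∞) ^ (n + 1)) :=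
        measurable_const.indicator hs
      have hs2 : (fun x => s.indicator (fun _ => (2⁻¹ : ℝ≥0∞) ^ (n + 1)) x +
          s.indicator (fun _ => (2⁻¹ : ℝ≥0∞) ^ (n + 1)) x) = s.indicator fun _ => 2⁻¹ ^ n := by
        funext x
        by_cases hx : x ∈ s <;> simp [hx, half]
      have h := hadd _ _ hm hm (fun x => by
        rw [congrFun hs2 x]
        refine Set.indicator_le' (fun _ _ => pow_le_one₀ zero_le (by simp)) (fun _ _ => ?_) x
        exact zero_le)
      rw [hs2, ih, ← two_mul] at h
      rw [pow_succ' _ n, mul_assoc, h, ← mul_assoc,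
        ENNReal.inv_mul_cancel (by simp) (by simp), one_mul, pow_succ' _ n]
  have hunion : ∀ s : ℕ → Set X, Pairwise (Function.onFun Disjoint s) →
      (fun x => ∑' n, (s n).indicator (fun _ => (1 : ℝ≥0∞)) x) =
        (⋃ n, s n).indicator fun _ => 1 := by
    intro s hd
    funext x
    by_cases hx : x ∈ ⋃ n, s n
    · obtain ⟨i, hi⟩ := Set.mem_iUnion.1 hx
      rw [Set.indicator_of_mem hx, tsum_eq_single i, Set.indicator_of_mem hi]
      exact fun j hj => Set.indicator_of_notMem (fun h => Set.disjoint_left.1 (hd hj) h hi) _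
    · rw [Set.indicator_of_notMem hx, ENNReal.tsum_eq_zero]
      exact fun i => Set.indicator_of_notMem (fun h => hx (Set.mem_iUnion.2 ⟨i, h⟩)) _
  let m : Measure X := Measure.ofMeasurable (fun s _ => Φ (s.indicator fun _ => 1))
    (by simpa using h0) (fun s hs hd => by
      simp only [← hunion s hd]
      refine hΦ _ (fun n => measurable_const.indicator (hs n)) fun x => ?_
      rw [congrFun (hunion s hd) x]
      exact Set.indicator_le' (fun _ _ => le_rfl) (fun _ _ => zero_le_one) x)
  have hm : ∀ s, MeasurableSet s → m s = Φ (s.indicator fun _ => 1) := fun s hs =>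
    Measure.ofMeasurable_apply s hs
  refine ⟨⟨m, ⟨by rw [hm _ MeasurableSet.univ, Set.indicator_univ, h1]⟩⟩, fun g hg hg1 => ?_⟩
  -- Preimages of the digit sets write `g` as a countable sum of multiples `2⁻¹ ^ (n + 1)` of
  -- indicators; both sides are additive over it.
  obtain ⟨S, hS, hsum⟩ := exists_binary_expansion
  have hgS : ∀ x, ∑' n, (g ⁻¹' S n).indicator (fun _ => (2⁻¹ : ℝ≥0∞) ^ (n + 1)) x = g x :=
    fun x => hsum (g x) (hg1 x)
  have hmeas : ∀ n, Measurable ((g ⁻¹' S n).indicator fun _ => (2⁻¹ : ℝ≥0∞) ^ (n + 1)) :=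
    fun n => measurable_const.indicator (hg (hS n))
  change _ = ∫⁻ x, g x ∂m
  have h := hΦ _ hmeas (fun x => (hgS x).trans_le (hg1 x))
  simp only [hgS] at h
  rw [h]
  simp_rw [← hgS]
  rw [lintegral_tsum fun n => (hmeas n).aemeasurable]
  refine tsum_congr fun n => ?_
  rw [hscale _ _ (hg (hS n)), lintegral_indicator_const (hg (hS n)), hm _ (hg (hS n))]

end Representation

/-! ### Averages of distributions and natural families -/

section Distributions

attribute [local instance] distMeasurableSpace

variable {X : Type u} [MeasurableSpace X]

theorem measurable_dist_iff {A : Type u} {f : X → PMF A} :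
    Measurable f ↔ ∀ a, Measurable fun x => f x a :=
  measurable_comap_iff.trans measurable_pi_iff

/-- The average `∫ f dμ` of a measurable family of distributions. -/
def average {A : Type u} [Countable A] (μ : ProbabilityMeasure X) (f : X → PMF A)
    (hf : Measurable f) : PMF A :=
  ⟨fun a => ∫⁻ x, f x a ∂(μ : Measure X), by
    rw [Summable.hasSum_iff ENNReal.summable,
      ← lintegral_tsum fun a => (measurable_dist_iff.1 hf a).aemeasurable]
    simp only [PMF.tsum_coe, lintegral_const, measure_univ, mul_one]⟩

theorem average_apply {A : Type u} [Countable A] (μ : ProbabilityMeasure X) {f : X → PMF A}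
    (hf : Measurable f) (a : A) : average μ f hf a = ∫⁻ x, f x a ∂(μ : Measure X) := rfl

theorem measurable_average {A : Type u} [Countable A] {f : X → PMF A} (hf : Measurable f) :
    Measurable fun μ : ProbabilityMeasure X => average μ f hf :=
  measurable_dist_iff.2 fun a =>
    (Measure.measurable_lintegral (measurable_dist_iff.1 hf a)).comp measurable_prob_toMeasure

/-- Tonelli: the sum over `A` and the integral over `X` are interchanged. -/
theorem average_bind {A B : Type u} [Countable A] [Countable B] (μ : ProbabilityMeasure X)
    {f : X → PMF A} (hf : Measurable f) (k : A → PMF B) :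
    average μ (fun x => (f x).bind k) ((measurable_dist_bind k).comp hf) =
      (average μ f hf).bind k := by
  ext b
  simp only [average_apply, PMF.bind_apply]
  rw [lintegral_tsum fun a => ((measurable_dist_iff.1 hf a).mul_const _).aemeasurable]
  exact tsum_congr fun a => lintegral_mul_const _ (measurable_dist_iff.1 hf a)

theorem average_probMap {A : Type u} [Countable A] {Y : Type u} [MeasurableSpace Y] {g : X → Y}
    (hg : Measurable g) (μ : ProbabilityMeasure X) {f : Y → PMF A} (hf : Measurable f) :
    average (probMap g hg μ) f hf = average μ (fun x => f (g x)) (hf.comp hg) := by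
  ext a
  exact lintegral_probMap hg μ (measurable_dist_iff.1 hf a)

theorem average_probDirac {A : Type u} [Countable A] (x : X) {f : X → PMF A} (hf : Measurable f) :
    average (probDirac x) f hf = f x := by
  ext a
  exact lintegral_dirac' x (measurable_dist_iff.1 hf a)

theorem average_probJoin {A : Type u} [Countable A] (P : ProbabilityMeasure (ProbabilityMeasure X))
    {f : X → PMF A} (hf : Measurable f) :
    average (probJoin P) f hf = average P (fun μ => average μ f hf) (measurable_average hf) := by
  ext a
  exact lintegral_probJoin P (measurable_dist_iff.1 hf a)

theorem tsum_option_eq_add {A : Type u} (g : Option A → ℝ≥0∞) :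
    ∑' o, g o = g none + ∑' a, g (some a) := by
  rw [← (Equiv.optionEquivSumPUnit.{0} A).symm.tsum_eq g,
    Summable.tsum_sum ENNReal.summable ENNReal.summable, add_comm]
  simp

/-- A subdistribution on `A`, completed to a distribution on `A` with an additional point. -/
def completion {A : Type u} (g : A → ℝ≥0∞) (hg : ∑' a, g a ≤ 1) : PMF (Option A) :=
  ⟨fun o => o.elim (1 - ∑' a, g a) g, by
    rw [Summable.hasSum_iff ENNReal.summable, tsum_option_eq_add]
    exact tsub_add_cancel_of_le hg⟩

theorem measurable_completion {A : Type u} [Countable A] {g : A → X → ℝ≥0∞}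
    (hg : ∀ a, Measurable (g a)) (hg1 : ∀ x, ∑' a, g a x ≤ 1) :
    Measurable fun x => completion (fun a => g a x) (hg1 x) :=
  measurable_dist_iff.2 fun o => match o with
    | none => (Measurable.tsum hg).const_sub 1
    | some a => hg a

/-- The total mass `1` fixes the remaining coordinate, so `D` of this two-point set is a copy of
`[0,1]`. -/
theorem dist_option_punit_ext {p q : PMF (Option PUnit.{u + 1})}
    (h : p (some PUnit.unit) = q (some PUnit.unit)) : p = q := by
  have key : ∀ p : PMF (Option PUnit.{u + 1}), p none = 1 - p (some PUnit.unit) := fun p => by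
    have := p.tsum_coe
    rw [tsum_option_eq_add, tsum_fintype] at this
    rw [← this]
    simp [ENNReal.add_sub_cancel_right (p.apply_ne_top _)]
  ext o
  match o with
  | none => rw [key p, key q, h]
  | some _ => exact h

open Classical in
/-- The characteristic map of a set. -/
def char {A : Type u} (s : Set A) : A → Option PUnit.{u + 1} :=
  fun a => if a ∈ s then some PUnit.unit else none

/-- Probabilities of arbitrary events become coordinates of a pushforward, where naturality applies.
-/
theorem map_char_apply {A : Type u} (p : PMF A) (s : Set A) :
    p.map (char s) (some PUnit.unit) = p.toOuterMeasure s := by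
  rw [← PMF.toOuterMeasure_apply_singleton, PMF.toOuterMeasure_map_apply]
  congr 1
  ext a
  by_cases h : a ∈ s <;> simp [char, h]

/-- Every family of distributions, indexed by the measurable maps `X → D A` and natural in the
countable set `A`, is given by averaging against a probability measure. -/
theorem exists_prob_average_eq
    (α : ∀ (A : Type u) [Countable A] (f : X → PMF A), Measurable f → PMF A)
    (hα : ∀ (A B : Type u) [Countable A] [Countable B] (k : A → B) (f : X → PMF A)
      (hf : Measurable f) (hf' : Measurable fun x => (f x).map k),
      α B (fun x => (f x).map k) hf' = (α A f hf).map k) :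
    ∃ μ : ProbabilityMeasure X, ∀ (A : Type u) [Countable A] (f : X → PMF A) (hf : Measurable f),
      α A f hf = average μ f hf := by
  classical
  -- A function is completed to a family on two points. The one-term sum matches the form of
  -- `completion`; the value `0` elsewhere is junk.
  let Φ : (X → ℝ≥0∞) → ℝ≥0∞ := fun g =>
    if h : Measurable g ∧ ∀ x, ∑' _ : PUnit.{u + 1}, g x ≤ 1 then
      α (Option PUnit) _ (measurable_completion (fun _ => h.1) h.2) (some PUnit.unit) else 0
  have key : ∀ (A : Type u) [Countable A] (f : X → PMF A) (hf : Measurable f) (s : Set A),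
      Φ (fun x => (f x).toOuterMeasure s) = (α A f hf).toOuterMeasure s := by
    intro A _ f hf s
    have hm : Measurable fun x => (f x).map (char s) :=
      (measurable_dist_bind (PMF.pure ∘ char s)).comp hf
    have h : Measurable (fun x => (f x).toOuterMeasure s) ∧
        ∀ x, ∑' _ : PUnit.{u + 1}, (f x).toOuterMeasure s ≤ 1 := by
      simp only [← map_char_apply]
      refine ⟨measurable_dist_iff.1 hm _, fun x => ?_⟩
      rw [tsum_fintype, Finset.univ_unique, Finset.sum_singleton]
      exact PMF.coe_le_one _ _
    simp only [Φ, dif_pos h]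
    rw [← map_char_apply, ← hα _ _ _ _ _ hm]
    congr 2
    funext x
    exact dist_option_punit_ext (map_char_apply _ _).symm
  have key_apply : ∀ (A : Type u) [Countable A] (f : X → PMF A) (hf : Measurable f) (a : A),
      Φ (fun x => f x a) = α A f hf a := by
    intro A _ f hf a
    have := key A f hf {a}
    simpa only [PMF.toOuterMeasure_apply_singleton] using this
  suffices h : ∃ μ : ProbabilityMeasure X, ∀ g : X → ℝ≥0∞, Measurable g → (∀ x, g x ≤ 1) →
      Φ g = ∫⁻ x, g x ∂(μ : Measure X) by
    obtain ⟨μ, hμ⟩ := h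
    refine ⟨μ, fun A _ f hf => ?_⟩
    ext a
    rw [average_apply, ← key_apply, hμ _ (measurable_dist_iff.1 hf a)]
    exact fun x => PMF.coe_le_one _ _
  refine exists_prob_lintegral_eq Φ ?_ ?_
  -- Normalization: a one-point set carries only one distribution.
  · have h : ∀ p : PMF PUnit.{u + 1}, p PUnit.unit = 1 := fun p => by
      rw [← p.tsum_coe, tsum_fintype]
      simp
    have := key_apply PUnit (fun _ => PMF.pure PUnit.unit) measurable_const PUnit.unit
    simpa only [h] using this
  · intro g hg hg1
    have htsum : ∀ g : ℕ → ℝ≥0∞, ∑' n : ULift.{u} ℕ, g n.down = ∑' n, g n :=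
      fun g => Equiv.ulift.tsum_eq g
    have hg1' : ∀ x, ∑' n : ULift.{u} ℕ, g n.down x ≤ 1 := fun x =>
      (htsum fun n => g n x).trans_le (hg1 x)
    -- The whole sequence becomes one family on `ℕ + 1`. The event `Set.range some` yields `Φ` of
    -- the sum, the single points yield the `Φ (g n)`. `ULift` only adjusts the universe.
    have hm := measurable_completion (g := fun n : ULift.{u} ℕ => g n.down)
      (fun n => hg n.down) hg1'
    have hrange : ∀ p : PMF (Option (ULift.{u} ℕ)),
        p.toOuterMeasure (Set.range some) = ∑' n, p (some (ULift.up n)) := fun p => by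
      rw [PMF.toOuterMeasure_apply, ← tsum_subtype, tsum_range _ (Option.some_injective _)]
      exact htsum fun n => p (some (ULift.up n))
    have h := key _ _ hm (Set.range some)
    simp only [hrange] at h
    refine h.trans (tsum_congr fun n => ?_)
    exact (key_apply _ _ hm (some (ULift.up n))).symm

/-- The two-valued family of distributions that is concentrated at the value of the indicator
function of `s`. -/
def indicatorDist (s : Set X) (x : X) : PMF (Option PUnit.{u + 1}) :=
  completion (fun _ => s.indicator (fun _ => 1) x) (by
    rw [tsum_fintype]
    simpa using Set.indicator_le' (fun _ _ => le_rfl) (fun _ _ => zero_le_one) x)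

theorem measurable_indicatorDist {s : Set X} (hs : MeasurableSet s) :
    Measurable (indicatorDist s) :=
  measurable_completion (fun _ => measurable_const.indicator hs) _

/-- This recovers a measure from its averages, giving both uniqueness and measurable dependence. -/
theorem average_indicatorDist (μ : ProbabilityMeasure X) {s : Set X} (hs : MeasurableSet s) :
    average μ (indicatorDist s) (measurable_indicatorDist hs) (some PUnit.unit) =
      (μ : Measure X) s :=
  lintegral_indicator_one hs

/-- A family of measurable maps `Y → D A`, indexed by the measurable maps `X → D A` and natural in
the countable set `A`, factors through a measurable map from `Y` to the probability measures
on `X`. -/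
theorem exists_measurable_average_eq {Y : Type u} [MeasurableSpace Y]
    (α : ∀ (A : Type u) [Countable A] (f : X → PMF A), Measurable f → Y → PMF A)
    (hαm : ∀ (A : Type u) [Countable A] (f : X → PMF A) (hf : Measurable f), Measurable (α A f hf))
    (hα : ∀ (A B : Type u) [Countable A] [Countable B] (k : A → B) (f : X → PMF A)
      (hf : Measurable f) (hf' : Measurable fun x => (f x).map k) (y : Y),
      α B (fun x => (f x).map k) hf' y = (α A f hf y).map k) :
    ∃ l : Y → ProbabilityMeasure X, Measurable l ∧
      ∀ (A : Type u) [Countable A] (f : X → PMF A) (hf : Measurable f) (y : Y),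
        average (l y) f hf = α A f hf y := by
  -- The measure is found separately for each `y`; measurability in `y` follows because each
  -- evaluation of `l y` is a coordinate of a measurable `α A f hf`.
  choose l hl using fun y => exists_prob_average_eq (fun A _ f hf => α A f hf y)
    fun A B _ _ k f hf hf' => hα A B k f hf hf' y
  refine ⟨l, measurable_of_measurable_prob_coe _ fun s hs => ?_,
    fun A _ f hf y => (hl y A f hf).symm⟩
  simp only [← average_indicatorDist _ hs, ← hl]
  exact measurable_dist_iff.1 (hαm _ _ _) _

theorem prob_ext_of_average {μ ν : ProbabilityMeasure X}
    (h : ∀ (A : Type u) [Countable A] (f : X → PMF A) (hf : Measurable f),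
      average μ f hf = average ν f hf) : μ = ν :=
  prob_ext fun s hs => by
    rw [← average_indicatorDist μ hs, ← average_indicatorDist ν hs, h]

/-- The barycenter of a probability measure on the space of distributions. -/
def barycenter {A : Type u} [Countable A] (P : ProbabilityMeasure (PMF A)) : PMF A :=
  average P id measurable_id

theorem measurable_barycenter {A : Type u} [Countable A] :
    Measurable (barycenter : ProbabilityMeasure (PMF A) → PMF A) :=
  measurable_average measurable_id

/-- This translates between the counit applied after a pushforward, as in the Kan extension cone,
and averages. -/
theorem barycenter_probMap {A : Type u} [Countable A] (μ : ProbabilityMeasure X) {f : X → PMF A}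
    (hf : Measurable f) : barycenter (probMap f hf μ) = average μ f hf :=
  average_probMap hf μ measurable_id

/-- This is naturality of the counit in Kleisli maps; plain maps are the case of point masses. -/
theorem barycenter_probMap_bind {A B : Type u} [Countable A] [Countable B] (k : A → PMF B)
    (P : ProbabilityMeasure (PMF A)) :
    barycenter (probMap (fun p => p.bind k) (measurable_dist_bind k) P) = (barycenter P).bind k :=
  (barycenter_probMap P _).trans (average_bind P measurable_id k)

theorem barycenter_probDirac {A : Type u} [Countable A] (p : PMF A) :
    barycenter (probDirac p) = p :=
  average_probDirac p measurable_id

theorem barycenter_probJoin {A : Type u} [Countable A]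
    (P : ProbabilityMeasure (ProbabilityMeasure (PMF A))) :
    barycenter (probJoin P) = barycenter (probMap barycenter measurable_barycenter P) :=
  (average_probJoin P measurable_id).trans (barycenter_probMap P measurable_barycenter).symm

end Distributions

/-! ### The pointwise Kan extensions -/

section Functors

attribute [local instance] distMeasurableSpace

/-- The barycenters as a transformation `G D ⟶ D` on countable sets. -/
def distCounit : distFunctor.{u} ⋙ giryMonad.toFunctor ⟶ distFunctor where
  app A := have := A.property; ⟨barycenter, measurable_barycenter⟩
  naturality A B k := Subtype.ext <| funext fun P =>
    have := A.property
    have := B.property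
    barycenter_probMap_bind (PMF.pure ∘ k.hom) P

/-- The barycenters as a transformation `G U ⟶ U` on the Kleisli category. -/
def kleisliCounit : kleisliForget.{u} ⋙ giryMonad.toFunctor ⟶ kleisliForget where
  app A := have := A.property; ⟨barycenter, measurable_barycenter⟩
  naturality A B k := Subtype.ext <| funext fun P =>
    have := A.property
    have := B.property
    barycenter_probMap_bind (kleisliFun k.hom) P

/-- The morphism of the Kleisli category given by a map of countable sets. -/
def pureKleisli {A B : CountableKleisli.{u}} (k : A.obj.of → B.obj.of) : A ⟶ B :=
  ⟨⟨TypeCat.ofHom fun a => PMF.pure (k a)⟩⟩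

/-- A measurable map `X → D A` as an object of the comma category of `X` and `D`. -/
def distArrow {X : MeasCat.{u}} {A : Type u} [hA : Countable A] (f : X → PMF A)
    (hf : Measurable f) : StructuredArrow X distFunctor.{u} :=
  let B : CountableSet := ⟨A, hA⟩
  let f' : X ⟶ distFunctor.obj B := ⟨f, hf⟩
  StructuredArrow.mk f'

/-- The Giry monad is the pointwise right Kan extension of `D` along itself. -/
def giryIsPointwiseDist :
    (Functor.RightExtension.mk giryMonad.toFunctor distCounit.{u}).IsPointwiseRightKanExtension :=
  fun X => Limits.IsLimit.ofExistsUnique fun s => by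
    obtain ⟨l, hl, h⟩ := exists_measurable_average_eq (X := X) (Y := s.pt)
      (fun A _ f hf => (s.π.app (distArrow f hf)).1)
      (fun A _ f hf => (s.π.app (distArrow f hf)).2)
      (fun A B _ _ k f hf hf' y => by
        -- Naturality of the family is compatibility of the cone along `k`, seen in the comma
        -- category.
        let φ : distArrow f hf ⟶ distArrow (fun x => (f x).map k) hf' :=
          StructuredArrow.homMk ⟨TypeCat.ofHom k⟩ rfl
        exact (congrFun (congrArg Subtype.val (s.w φ)) y).symm)
    refine ⟨⟨l, hl⟩, fun j => Subtype.ext <| funext fun y => ?_,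
      fun l' hl' => Subtype.ext <| funext fun y => prob_ext_of_average fun A _ f hf => ?_⟩
    · have := j.right.property
      exact (barycenter_probMap (l y) j.hom.2).trans (h _ _ j.hom.2 y)
    · refine Eq.trans ?_ (h A f hf y).symm
      refine (barycenter_probMap (l'.1 y) hf).symm.trans ?_
      exact congrFun (congrArg Subtype.val (hl' (distArrow f hf))) y

/-- A measurable map `X → D A` as an object of the comma category of `X` and `U`. -/
def kleisliArrow {X : MeasCat.{u}} {A : Type u} [hA : Countable A] (f : X → PMF A)
    (hf : Measurable f) : StructuredArrow X kleisliForget.{u} :=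
  let B : CountableKleisli := ⟨Kleisli.mk _ A, hA⟩
  let f' : X ⟶ kleisliForget.obj B := ⟨f, hf⟩
  StructuredArrow.mk f'

/-- The Giry monad is the pointwise right Kan extension of `U` along itself. -/
def giryIsPointwiseKleisli :
    (Functor.RightExtension.mk giryMonad.toFunctor kleisliCounit.{u}).IsPointwiseRightKanExtension :=
  fun X => Limits.IsLimit.ofExistsUnique fun s => by
    obtain ⟨l, hl, h⟩ := exists_measurable_average_eq (X := X) (Y := s.pt)
      (fun A _ f hf => (s.π.app (kleisliArrow f hf)).1)
      (fun A _ f hf => (s.π.app (kleisliArrow f hf)).2)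
      (fun A B _ _ k f hf hf' y => by
        -- Deterministic Kleisli maps suffice to produce the measure.
        let φ : kleisliArrow f hf ⟶ kleisliArrow (fun x => (f x).map k) hf' :=
          StructuredArrow.homMk (pureKleisli k) rfl
        exact (congrFun (congrArg Subtype.val (s.w φ)) y).symm)
    refine ⟨⟨l, hl⟩, fun j => Subtype.ext <| funext fun y => ?_,
      fun l' hl' => Subtype.ext <| funext fun y => prob_ext_of_average fun A _ f hf => ?_⟩
    · have := j.right.property
      exact (barycenter_probMap (l y) j.hom.2).trans (h _ _ j.hom.2 y)
    · refine Eq.trans ?_ (h A f hf y).symm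
      refine (barycenter_probMap (l'.1 y) hf).symm.trans ?_
      exact congrFun (congrArg Subtype.val (hl' (kleisliArrow f hf))) y

end Functors

end Codensity

end

theorem theorem6p9 :
    Codensity.IsCodensityMonadOf Codensity.giryMonad.{u} Codensity.distFunctor.{u} ∧
    Codensity.IsCodensityMonadOf Codensity.giryMonad.{u} Codensity.kleisliForget.{u} := by
  constructor
  · refine Codensity.isCodensityMonadOf_of_isPointwise _ _ Codensity.distCounit
      Codensity.giryIsPointwiseDist (fun A => ?_) (fun A => ?_) <;> have := A.property
    -- The two remaining goals are the unit and associativity laws of the algebra `D A`.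
    · exact Subtype.ext <| funext Codensity.barycenter_probDirac
    · exact Subtype.ext <| funext Codensity.barycenter_probJoin
  · refine Codensity.isCodensityMonadOf_of_isPointwise _ _ Codensity.kleisliCounit
      Codensity.giryIsPointwiseKleisli (fun A => ?_) (fun A => ?_) <;> have := A.property
    · exact Subtype.ext <| funext Codensity.barycenter_probDirac
    · exact Subtype.ext <| funext Codensity.barycenter_probJoin
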